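/- **Theorem (Plancherel theorem for the continuous wavelet transform on a local field).** Let $\mathbb{K}$ be a non-archimedean local field, $dx$ a Haar measure on its additive group, and $|\cdot|$ its absolute value, normalised by $d(\alpha x)=|\alpha|\,dx$ for $\alpha\neq 0$ and $|0|=0$. Let $\mathfrak{D}$ be the ring of integers of $\mathbb{K}$, $\mathfrak{P}$ its prime ideal, and let $\chi$ be a continuous unitary character of the additive group of $\mathbb{K}$ that is trivial on $\mathfrak{D}$ but not on $\mathfrak{P}^{-1}$. Let $\hat f$ denote the Fourier transform of $f\in L^2(\mathbb{K})$, that is, the extension to $L^2(\mathbb{K})$ by continuity of $\hat f(\xi)=\int_{\mathbb{K}} f(x)\chi(-\xi x)\,dx$, $f\in L^1(\mathbb{K})\cap L^2(\mathbb{K})$. Let $\psi\in L^2(\mathbb{K})$ be an admissible wavelet, i.e. $$c_\psi=\int_{\mathbb{K}}\frac{|\hat\psi(\xi)|^2}{|\xi|}\,d\xi<\infty ,$$ and for $f\in L^2(\mathbb{K})$, $a,b\in\mathbb{K}$, $a\ne 0$, put $$(K_\psi f)(a,b)=\int_{\mathbb{K}} f(x)\,\overline{\psi_{a,b}(x)}\,dx,\qquad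 \psi_{a,b}(x)=|a|^{-1/2}\,\psi\!\left(\frac{x-b}{a}\right).$$ Then for all $f,g\in L^2(\mathbb{K})$ the functions $K_\psi f$ and $K_\psi g$ belong to $L^2\big(\mathbb{K}\times\mathbb{K},\,|a|^{-2}\,da\,db\big)$ and $$\int_{\mathbb{K}\times\mathbb{K}} (K_\psi f)(a,b)\,\overline{(K_\psi g)(a,b)}\,\frac{da\,db}{|a|^2}=c_\psi\int_{\mathbb{K}} f(x)\,\overline{g(x)}\,dx .$$ In particular (with $f=g$) $$\int_{\mathbb{K}\times\mathbb{K}} |(K_\psi f)(a,b)|^2\,\frac{da\,db}{|a|^2}=c_\psi\,\|f\|_{L^2(\mathbb{K})}^2 ,$$ so $K_\psi$ is an isometry up to the constant factor $c_\psi$. -/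

import Mathlib

open MeasureTheory Filter Topology ValuativeRel
open scoped NNReal ENNReal ComplexConjugate

namespace LocalFieldCWT

noncomputable section

section AbsoluteValue

variable {K : Type*} [Field K] [ValuativeRel K] [TopologicalSpace K]
  [IsNonarchimedeanLocalField K] [MeasurableSpace K] [BorelSpace K]

open Classical in
/-- The absolute value of a local field: `|0| = 0`, and for `x ≠ 0` it is the factor by which
multiplication by `x` scales additive Haar measure, `d(x y) = |x| dy`. -/
def absK (x : K) : ℝ≥0 :=
  if h : x = 0 then 0 else distribHaarChar K (Units.mk0 x h)

/-- The daughter wavelet `ψ_{a,b}(x) = |a|^{-1/2} ψ((x - b) / a)` (meaningful for `a ≠ 0`). -/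
def daughter (ψ : K → ℂ) (a b : K) (x : K) : ℂ :=
  (((Real.sqrt (absK a))⁻¹ : ℝ) : ℂ) * ψ ((x - b) / a)

/-- The continuous wavelet transform
`(K_ψ f)(a, b) = (f, ψ_{a,b}) = ∫ f(x) conj (ψ_{a,b}(x)) dx`. -/
def cwt (μ : Measure K) (ψ f : K → ℂ) (p : K × K) : ℂ :=
  ∫ x, f x * conj (daughter ψ p.1 p.2 x) ∂μ

/-- The measure `da db / |a|²` on `K × K` (the slice `a = 0` is a null set). -/
def cwtMeasure (μ : Measure K) : Measure (K × K) :=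
  (μ.prod μ).withDensity fun p => (((absK p.1 ^ 2)⁻¹ : ℝ≥0) : ℝ≥0∞)

/-- `χ` is a continuous unitary character of the additive group of `K` that is trivial on the ring
of integers `𝒪[K]` and nontrivial on the inverse `{x | x 𝓂[K] ⊆ 𝒪[K]}` of the prime ideal. -/
structure IsBasicCharacter (χ : AddChar K Circle) : Prop where
  continuous : Continuous χ
  trivial_on_integers : ∀ x ∈ 𝒪[K], χ x = 1
  nontrivial_on_inverse :
    ∃ x : K, (∀ y : 𝒪[K], y ∈ 𝓂[K] → x * (y : K) ∈ 𝒪[K]) ∧ χ x ≠ 1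

/-- `F` represents the `L²` Fourier transform of `f ∈ L²`: it is an `L²` limit of the Fourier
integrals `ξ ↦ ∫ u_n(x) χ(-ξ x) dx` of some functions `u_n ∈ L¹ ∩ L²` that tend to `f` in `L²`. -/
def IsL2Fourier (χ : AddChar K Circle) (μ : Measure K) (f F : K → ℂ) : Prop :=
  MemLp F 2 μ ∧ ∃ u : ℕ → K → ℂ,
    (∀ n, Integrable (u n) μ ∧ MemLp (u n) 2 μ) ∧
    Tendsto (fun n => eLpNorm (u n - f) 2 μ) atTop (𝓝 0) ∧
    Tendsto (fun n => eLpNorm (Fourier.fourierIntegral χ μ (u n) - F) 2 μ) atTop (𝓝 0)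

/-- The Fourier transform on `L²`. By Plancherel's theorem each `f ∈ L²` has a Fourier transform
in the sense of `IsL2Fourier`, unique up to equality almost everywhere; this is a representative. -/
def fourierL2 (χ : AddChar K Circle) (μ : Measure K) (f : K → ℂ) : K → ℂ :=
  Classical.epsilon (IsL2Fourier χ μ f)

/-- The constant `c_ψ = ∫ |ψ̂(ξ)|² / |ξ| dξ ∈ [0, ∞]`. -/
def admissibilityConst (χ : AddChar K Circle) (μ : Measure K) (ψ : K → ℂ) : ℝ≥0∞ :=
  ∫⁻ ξ, ‖fourierL2 χ μ ψ ξ‖ₑ ^ 2 / (absK ξ : ℝ≥0∞) ∂μ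

/-- `ψ` is an admissible wavelet: `ψ ∈ L²` and `c_ψ < ∞`. -/
def IsAdmissible (χ : AddChar K Circle) (μ : Measure K) (ψ : K → ℂ) : Prop :=
  MemLp ψ 2 μ ∧ admissibilityConst χ μ ψ < ∞

end AbsoluteValue

/-- The `L²` inner product `(f, g) = ∫ f conj g`, linear in the first argument. -/
def l2Inner {X : Type*} [MeasurableSpace X] (μ : Measure X) (f g : X → ℂ) : ℂ :=
  ∫ x, f x * conj (g x) ∂μ

end

end LocalFieldCWT

set_option linter.unusedSectionVars false

/-! For fixed `a ≠ 0`, Parseval turns `b ↦ (K_ψ f)(a, b)` into a Fourier integral of `G_a(ξ) = f̂(ξ)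
conj(|a|^{1/2} ψ̂(aξ))`, because translating the wavelet by `b` only multiplies its transform by a
character (`cwt_eq_fourierIntegral`). Plancherel in `b` then gives `∫ |K_ψ f(a, b)|² db` in terms of
`∫ |a| |f̂(ξ)|² |ψ̂(aξ)|² dξ`. Integrating against `da / |a|²`, Tonelli and the invariance of `da /
|a|` under `a ↦ aξ` split off `c_ψ` (`lintegral_lintegral_daughterHat`). This is the norm identity
`eLpNorm_cwt_sq`; the inner products follow by polarization.

The Haar measure is not normalised, so the Fourier transform multiplies `L²` norms by `m = μ(𝒪[K])`;
these factors cancel in the end.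

Plancherel itself is proved by hand. The transform of the indicator of `ball c` is `μ(ball c)` times
the indicator of `ball c⁻¹`. Hence the integral of `|f̂|²` over a large ball is `m²` times the
average of the autocorrelation of `f` over a small one, and tends to `m² ‖f‖²`. Density carries this
to `L²`. -/

namespace LocalFieldCWT

/-! ### Balls and the topology of the field -/

section Balls

open scoped Pointwise

section Algebra

variable {K : Type*} [Field K] [ValuativeRel K]

/-- The ball `c 𝒪[K]`. -/
def ball (c : K) : Set K := {x | valuation K x ≤ valuation K c}

lemma zero_mem_ball (c : K) : (0 : K) ∈ ball c := by simp [ball]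

lemma neg_mem_ball {c x : K} : -x ∈ ball c ↔ x ∈ ball c := by simp [ball]

lemma add_mem_ball {c x y : K} (hx : x ∈ ball c) (hy : y ∈ ball c) : x + y ∈ ball c := by
  simp only [ball, Set.mem_ofPred_eq] at *
  exact (valuation K).map_add_le hx hy

lemma mul_mem_ball_iff {a c x : K} (ha : a ≠ 0) : a * x ∈ ball c ↔ x ∈ ball (a⁻¹ * c) := by
  have : 0 < valuation K a := by simpa [zero_lt_iff] using ha
  simp only [ball, Set.mem_ofPred_eq, map_mul, map_inv₀]
  rw [le_inv_mul_iff₀ this]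

lemma smul_ball (a : Kˣ) (c : K) : a • ball c = ball (a * c) := by
  ext x
  rw [Set.mem_smul_set_iff_inv_smul_mem, Units.smul_def, smul_eq_mul, mul_mem_ball_iff (by simp)]
  simp

end Algebra

variable {K : Type*} [Field K] [ValuativeRel K] [TopologicalSpace K]
  [IsNonarchimedeanLocalField K]

lemma isCompact_ball (c : K) : IsCompact (ball c) :=
  IsNonarchimedeanLocalField.isCompact_closedBall K _

lemma isClosed_ball (c : K) : IsClosed (ball c) := by
  have := Valuation.isClosed_closedBall (v := valuation K) ((valuation K).restrict c)
  simpa only [ball, Valuation.restrict_le_iff] using this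

lemma isOpen_ball {c : K} (hc : c ≠ 0) : IsOpen (ball c) := by
  have := Valuation.isOpen_closedBall (v := valuation K) (r := (valuation K).restrict c) (by simpa)
  simpa only [ball, Valuation.restrict_le_iff] using this

instance t1Space : T1Space K := by
  refine IsTopologicalAddGroup.t1Space K ?_
  convert isClosed_ball (0 : K) using 1
  ext; simp [ball]

variable (K) in
-- Powers `c n = t⁻ⁿ` with `t` of valuation less than 1 work because the value group is archimedean.
-- The balls of `c n` exhaust `K` while the dual balls of `(c n)⁻¹` shrink to 0.
lemma exists_ball_sequence : ∃ c : ℕ → K, (∀ n, c n ≠ 0) ∧ (Monotone fun n => ball (c n)) ∧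
    (∀ x, ∀ᶠ n in atTop, x ∈ ball (c n)) ∧ (𝓝 0).HasAntitoneBasis fun n => ball (c n)⁻¹ := by
  obtain ⟨t, ht, ht1⟩ := Valuation.IsNontrivial.exists_lt_one (v := valuation K)
  have ht : t ≠ 0 := by simpa using ht
  have hv : 0 < valuation K t := by simpa [zero_lt_iff] using ht
  have key : ∀ y : K, y ≠ 0 → ∃ n, valuation K t ^ n < valuation K y := fun y hy =>
    exists_pow_lt₀ ht1 (Units.mk0 (valuation K y) (by simpa using hy))
  have mono : ∀ {m n : ℕ}, m ≤ n → valuation K t ^ n ≤ valuation K t ^ m := fun h =>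
    pow_le_pow_right_of_le_one' ht1.le h
  refine ⟨fun n => (t ^ n)⁻¹, fun n => by simp [ht], fun m n h x hx => ?_, fun x => ?_,
    ⟨⟨fun s => ?_⟩, ?_⟩⟩
  · simp only [ball, Set.mem_ofPred_eq, map_inv₀, map_pow] at hx ⊢
    exact hx.trans (inv_anti₀ (pow_pos hv _) (mono h))
  · rcases eq_or_ne x 0 with rfl | hx
    · exact .of_forall fun n => zero_mem_ball _
    obtain ⟨n, hn⟩ := key x⁻¹ (by simpa)
    filter_upwards [eventually_ge_atTop n] with m hm
    simp only [ball, Set.mem_ofPred_eq, map_inv₀, map_pow] at hn ⊢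
    rw [le_inv_comm₀ (by simpa [zero_lt_iff] using hx) (pow_pos hv _)]
    exact (mono hm).trans hn.le
  · rw [(IsValuativeTopology.hasBasis_nhds_zero' K).mem_iff]
    constructor
    · rintro ⟨γ, hγ, h⟩
      obtain ⟨y, rfl⟩ := ValuativeRel.valuation_surjective γ
      obtain ⟨n, hn⟩ := key y (by simpa using hγ)
      refine ⟨n, trivial, fun x hx => h ?_⟩
      simp only [ball, Set.mem_ofPred_eq, inv_inv, map_pow] at hx ⊢
      exact hx.trans_lt hn
    · rintro ⟨n, -, h⟩
      refine ⟨valuation K t ^ n, (pow_pos hv n).ne', fun x hx => h ?_⟩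
      simp only [ball, Set.mem_ofPred_eq, inv_inv, map_pow] at hx ⊢
      exact le_of_lt hx
  · intro m n h x hx
    simp only [ball, Set.mem_ofPred_eq, inv_inv, map_pow] at hx ⊢
    exact hx.trans (mono h)

instance sigmaCompactSpace : SigmaCompactSpace K := by
  obtain ⟨c, -, -, h, -⟩ := exists_ball_sequence K
  exact ⟨⟨fun n => ball (c n), fun n => isCompact_ball _,
    Set.eq_univ_of_forall fun x => Set.mem_iUnion.2 (h x).exists⟩⟩

instance secondCountableTopology : SecondCountableTopology K := by
  obtain ⟨c, -, -, -, h⟩ := exists_ball_sequence K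
  have : (𝓝 (0 : K)).IsCountablyGenerated := h.1.isCountablyGenerated
  -- A countable neighbourhood basis at 0 makes the group pseudometrizable; with σ-compactness this
  -- gives second countability.
  let := IsTopologicalAddGroup.rightUniformSpace K
  have := isUniformAddGroup_of_addCommGroup (G := K)
  have : (uniformity K).IsCountablyGenerated := IsUniformAddGroup.uniformity_countably_generated
  let := TopologicalSpace.pseudoMetrizableSpacePseudoMetric K
  exact EMetric.secondCountable_of_sigmaCompact K

end Balls

/-! ### Haar measure under multiplication, and the absolute value -/

section Scaling

open scoped Pointwise

variable {K : Type*} [Field K] [ValuativeRel K] [TopologicalSpace K]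
  [IsNonarchimedeanLocalField K] [MeasurableSpace K] [BorelSpace K]

lemma absK_zero : absK (0 : K) = 0 := by simp [absK]

lemma absK_of_ne_zero {a : K} (ha : a ≠ 0) : absK a = distribHaarChar K (Units.mk0 a ha) := by
  simp [absK, ha]

lemma absK_pos {a : K} (ha : a ≠ 0) : 0 < absK a := by
  rw [absK_of_ne_zero ha]; exact distribHaarChar_pos

lemma absK_mul (a b : K) : absK (a * b) = absK a * absK b := by
  rcases eq_or_ne a 0 with rfl | ha
  · simp [absK_zero]
  rcases eq_or_ne b 0 with rfl | hb
  · simp [absK_zero]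
  rw [absK_of_ne_zero ha, absK_of_ne_zero hb, absK_of_ne_zero (mul_ne_zero ha hb), ← map_mul]
  congr 1
  ext; simp

lemma absK_inv (a : K) : absK a⁻¹ = (absK a)⁻¹ := by
  rcases eq_or_ne a 0 with rfl | ha
  · simp [absK_zero]
  rw [absK_of_ne_zero ha, absK_of_ne_zero (inv_ne_zero ha), ← map_inv]
  congr 1
  ext; simp

variable (μ : Measure K) [μ.IsAddHaarMeasure]

lemma measure_ball (c : K) (hc : c ≠ 0) : μ (ball c) = absK c * μ (ball 1) := by
  rw [absK_of_ne_zero hc, distribHaarChar_mul, smul_ball, Units.val_mk0, mul_one]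

lemma measure_ball_lt_top (c : K) : μ (ball c) < ∞ := (isCompact_ball c).measure_lt_top

lemma measure_ball_pos {c : K} (hc : c ≠ 0) : 0 < μ (ball c) :=
  (isOpen_ball hc).measure_pos μ ⟨0, zero_mem_ball c⟩

/-- The scaling factors of dual balls are inverse to each other. This identity stands in for a
normalisation of `μ`. -/
lemma measure_ball_mul_inv {c : K} (hc : c ≠ 0) :
    μ.real (ball c) * μ.real (ball c⁻¹) = μ.real (ball 1) ^ 2 := by
  have : (absK c : ℝ) ≠ 0 := by exact_mod_cast (absK_pos hc).ne'
  simp only [Measure.real, measure_ball μ c hc, measure_ball μ c⁻¹ (inv_ne_zero hc), absK_inv,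
    ENNReal.toReal_mul, ENNReal.coe_toReal, NNReal.coe_inv]
  field_simp

lemma map_mul_left_eq_smul {a : K} (ha : a ≠ 0) :
    μ.map (a * ·) = (absK a)⁻¹ • μ := by
  ext s hs
  rw [Measure.map_apply (measurable_const_mul a) hs, Measure.smul_apply]
  have h : (a * ·) ⁻¹' s = (Units.mk0 a ha)⁻¹ • s := by
    ext x
    rw [Set.mem_smul_set_iff_inv_smul_mem]
    simp [Units.smul_def]
  rw [h, ← distribHaarChar_mul, map_inv, ← absK_of_ne_zero ha]
  rfl

lemma lintegral_comp_mul_left {a : K} (ha : a ≠ 0) (f : K → ℝ≥0∞) :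
    ∫⁻ x, f (a * x) ∂μ = (absK a : ℝ≥0∞)⁻¹ * ∫⁻ x, f x ∂μ := by
  have := lintegral_map_equiv (μ := μ) f (MeasurableEquiv.mulLeft₀ a ha)
  rw [MeasurableEquiv.coe_mulLeft₀, map_mul_left_eq_smul μ ha, lintegral_smul_measure] at this
  rw [← this, ENNReal.smul_def, ENNReal.coe_inv (absK_pos ha).ne', smul_eq_mul]

lemma integral_comp_mul_left {a : K} (ha : a ≠ 0) (f : K → ℂ) :
    ∫ x, f (a * x) ∂μ = ((absK a : ℝ)⁻¹ : ℝ) * ∫ x, f x ∂μ := by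
  have := integral_map_equiv (μ := μ) (MeasurableEquiv.mulLeft₀ a ha) f
  rw [MeasurableEquiv.coe_mulLeft₀, map_mul_left_eq_smul μ ha, integral_smul_nnreal_measure] at this
  rw [← this, NNReal.smul_def, Complex.real_smul, NNReal.coe_inv]

open Classical in
lemma measurable_absK : Measurable (absK : K → ℝ≥0) := by
  let μ : Measure K := Measure.addHaar
  have key : ∀ a : K, a ≠ 0 → μ (ball a) / μ (ball 1) = absK a := fun a ha => by
    rw [measure_ball μ a ha, ENNReal.mul_div_cancel_right (measure_ball_pos μ one_ne_zero).ne'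
      (measure_ball_lt_top μ _).ne]
  -- Up to the constant `μ (ball 1)`, `|a|` is the measure of the slice at `a` of one measurable
  -- subset of `K × K`, hence measurable in `a`.
  have h : (absK : K → ℝ≥0) = fun a => if a = 0 then 0 else
      (μ (Prod.mk a ⁻¹' {p : K × K | p.1⁻¹ * p.2 ∈ ball (1 : K)}) / μ (ball 1)).toNNReal := by
    ext a
    split_ifs with ha
    · simp [ha, absK_zero]
    · have : Prod.mk a ⁻¹' {p : K × K | p.1⁻¹ * p.2 ∈ ball (1 : K)} = ball a := by
        ext x
        simp only [Set.mem_preimage, Set.mem_ofPred_eq]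
        rw [mul_mem_ball_iff (inv_ne_zero ha)]
        simp
      rw [this, key a ha]
      simp
  rw [h]
  refine Measurable.ite (measurableSet_singleton 0) measurable_const ?_
  refine ((measurable_measure_prodMk_left ?_).div_const _).ennreal_toNNReal
  exact (measurable_fst.inv.mul measurable_snd) (isClosed_ball 1).measurableSet

instance nullSingletonClass : NullSingletonClass μ := by
  have : (𝓝[≠] (0 : K)).NeBot := by
    obtain ⟨c, hc, -, -, h⟩ := exists_ball_sequence K
    rw [(nhdsWithin_hasBasis h.1 _).neBot_iff]
    exact fun {n} _ => ⟨(c n)⁻¹, by simp [ball], by simp [hc n]⟩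
  exact Measure.IsAddHaarMeasure.nullSingletonClass μ

end Scaling
-- Plancherel's theorem on `L¹ ∩ L²`
section Plancherel

variable {K : Type*} [Field K] [ValuativeRel K] [TopologicalSpace K]
  [IsNonarchimedeanLocalField K] [MeasurableSpace K] [BorelSpace K]
  {χ : AddChar K Circle}

/-- Here `(zc)⁻¹` lies in the maximal ideal, so if `x` witnesses nontriviality of `χ`, then `x
(zc)⁻¹` is integral and `y = z⁻¹ x` lies in `ball c`, with `χ (z y) = χ x`. -/
lemma exists_ne_one_of_notMem_ball (hχ : IsBasicCharacter χ) {c z : K} (hc : c ≠ 0)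
    (hz : z ∉ ball c⁻¹) : ∃ y ∈ ball c, χ (z * y) ≠ 1 := by
  obtain ⟨x, hx, hx1⟩ := hχ.nontrivial_on_inverse
  have hz0 : z ≠ 0 := fun h => hz (h ▸ zero_mem_ball _)
  have hzc : 1 < valuation K (z * c) := by
    rw [ball, Set.mem_ofPred_eq, not_le, map_inv₀, inv_lt_iff_one_lt_mul₀
      (by simpa [zero_lt_iff] using hc)] at hz
    simpa using hz
  have hlt : valuation K (z * c)⁻¹ < 1 := by
    rw [map_inv₀]; exact inv_lt_one_of_one_lt₀ hzc
  have hm : (⟨(z * c)⁻¹, hlt.le⟩ : 𝒪[K]) ∈ 𝓂[K] := by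
    rw [IsLocalRing.mem_maximalIdeal, mem_nonunits_iff]
    intro hu
    exact hlt.ne ((Valuation.integer.integers (valuation K)).isUnit_iff_valuation_eq_one.1 hu)
  have h1 := hx _ hm
  rw [Valuation.mem_integer_iff] at h1
  refine ⟨z⁻¹ * x, ?_, by rwa [mul_inv_cancel_left₀ hz0]⟩
  rw [mul_mem_ball_iff (inv_ne_zero hz0), inv_inv, ← inv_inv (z * c),
    ← mul_one (z * c)⁻¹⁻¹, ← mul_mem_ball_iff (inv_ne_zero (mul_ne_zero hz0 hc)), mul_comm]
  simpa [ball] using h1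

lemma apply_mul_eq_one (hχ : IsBasicCharacter χ) {c z y : K} (hc : c ≠ 0)
    (hz : z ∈ ball c⁻¹) (hy : y ∈ ball c) : χ (z * y) = 1 := by
  apply hχ.trivial_on_integers
  rw [Valuation.mem_integer_iff, map_mul]
  calc valuation K z * valuation K y ≤ valuation K c⁻¹ * valuation K c := mul_le_mul' hz hy
    _ = 1 := by rw [← map_mul, inv_mul_cancel₀ hc, map_one]

variable (μ : Measure K) [μ.IsAddHaarMeasure]

lemma setIntegral_character (hχ : IsBasicCharacter χ) {c : K} (hc : c ≠ 0) (z : K) :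
    ∫ y in ball c, (χ (z * y) : ℂ) ∂μ = (ball c⁻¹).indicator (fun _ => (μ.real (ball c) : ℂ)) z := by
  by_cases hz : z ∈ ball c⁻¹
  · rw [Set.indicator_of_mem hz, setIntegral_congr_fun (g := fun _ => (1 : ℂ))
      (isClosed_ball c).measurableSet fun y hy => by simp [apply_mul_eq_one hχ hc hz hy]]
    simp
  · rw [Set.indicator_of_notMem hz]
    obtain ⟨w, hw, hw1⟩ := exists_ne_one_of_notMem_ball hχ hc hz
    set f : K → ℂ := (ball c).indicator fun y => (χ (z * y) : ℂ) with hf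
    -- Orthogonality: translation by `w` preserves the ball and multiplies the integral by `χ (z w)
    -- ≠ 1`, so the integral is 0.
    have hshift : ∀ y, f (y + w) = χ (z * w) * f y := fun y => by
      have : y + w ∈ ball c ↔ y ∈ ball c :=
        ⟨fun h => by simpa using add_mem_ball h (neg_mem_ball.2 hw), fun h => add_mem_ball h hw⟩
      by_cases hy : y ∈ ball c
      · rw [hf, Set.indicator_of_mem hy, Set.indicator_of_mem (this.2 hy), mul_add,
          AddChar.map_add_eq_mul, Circle.coe_mul, mul_comm]
      · rw [hf, Set.indicator_of_notMem hy, Set.indicator_of_notMem (this.not.2 hy), mul_zero]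
    have h : ∫ y, f y ∂μ = χ (z * w) * ∫ y, f y ∂μ := by
      rw [← integral_const_mul, ← integral_add_right_eq_self f w]
      exact integral_congr_ae (.of_forall hshift)
    rw [← integral_indicator (isClosed_ball c).measurableSet]
    by_contra h0
    exact hw1 (Circle.ext (by simpa using (mul_eq_right₀ h0).1 h.symm))

lemma continuous_fourierIntegral (hχ : IsBasicCharacter χ) {f : K → ℂ} (hf : Integrable f μ) :
    Continuous (Fourier.fourierIntegral χ μ f) :=
  VectorFourier.fourierIntegral_continuous hχ.continuous continuous_mul hf

lemma fourierIntegral_add (hχ : IsBasicCharacter χ) {f g : K → ℂ} (hf : Integrable f μ)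
    (hg : Integrable g μ) : Fourier.fourierIntegral χ μ (f + g) =
      Fourier.fourierIntegral χ μ f + Fourier.fourierIntegral χ μ g :=
  VectorFourier.fourierIntegral_add (L := LinearMap.mul K K) hχ.continuous continuous_mul hf hg

lemma integral_fourierIntegral_mul (hχ : IsBasicCharacter χ) {f g : K → ℂ} (hf : Integrable f μ)
    (hg : Integrable g μ) : ∫ ξ, Fourier.fourierIntegral χ μ f ξ * g ξ ∂μ =
      ∫ x, f x * Fourier.fourierIntegral χ μ g x ∂μ := by
  have := VectorFourier.integral_fourierIntegral_smul_eq_flip (μ := μ) (ν := μ)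
    (L := LinearMap.mul K K) hχ.continuous continuous_mul hf hg
  rwa [LinearMap.flip_mul] at this

lemma conj_fourierIntegral (f : K → ℂ) (ξ : K) : conj (Fourier.fourierIntegral χ μ f ξ) =
    Fourier.fourierIntegral χ μ (fun x => conj (f x)) (-ξ) := by
  simp only [Fourier.fourierIntegral_def, ← integral_conj, Circle.smul_def, smul_eq_mul, map_mul,
    mul_neg, neg_neg, AddChar.map_neg_eq_inv, ← Circle.coe_inv_eq_conj, inv_inv]

/-- The autocorrelation of `f`. -/
noncomputable def autocorrelation (f : K → ℂ) (t : K) : ℂ := ∫ x, f x * conj (f (x + t)) ∂μ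

variable {μ}

lemma integrable_mul_conj_add {f : K → ℂ} (hf : Integrable f μ) (s : Set K) :
    Integrable (fun p : K × K => f p.1 * conj (f (p.1 + p.2))) (μ.prod (μ.restrict s)) := by
  have h : Integrable (fun p : K × K => f p.1 * conj (f p.2)) (μ.prod μ) :=
    hf.mul_prod (Complex.conjCLE.toContinuousLinearMap.integrable_comp hf)
  -- The shear `(x, t) ↦ (x, x + t)` preserves the product measure.
  have := (measurePreserving_prod_add μ μ).integrable_comp_of_integrable h
  exact this.mono_measure (Measure.prod_mono le_rfl Measure.restrict_le_self)

/-- The multiplication formula moves the transform from the first factor onto the truncated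
conjugate of the second; Fubini then produces the autocorrelation. -/
lemma setIntegral_normSq_fourierIntegral (hχ : IsBasicCharacter χ) {f : K → ℂ}
    (hf : Integrable f μ) {c : K} (hc : c ≠ 0) :
    ∫ ξ in ball c, Fourier.fourierIntegral χ μ f ξ * conj (Fourier.fourierIntegral χ μ f ξ) ∂μ =
      μ.real (ball c) * ∫ t in ball c⁻¹, autocorrelation μ f t ∂μ := by
  have hB := (isClosed_ball c).measurableSet
  have hB' := (isClosed_ball c⁻¹).measurableSet
  have hconj : Integrable (fun x => conj (f x)) μ :=
    Complex.conjCLE.toContinuousLinearMap.integrable_comp hf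
  have hcont := continuous_fourierIntegral μ hχ hf
  have hball : ∀ g : K → ℂ, Continuous g → Integrable ((ball c).indicator g) μ := fun g hg =>
    (integrable_indicator_iff hB).2 (hg.continuousOn.integrableOn_compact (isCompact_ball c))
  -- Transforming the truncation to `ball c` averages `conj f` over `x + ball c⁻¹`, since the
  -- transform of one ball's indicator is supported on the dual ball.
  have hFg : ∀ x, Fourier.fourierIntegral χ μ
      ((ball c).indicator fun ξ => conj (Fourier.fourierIntegral χ μ f ξ)) x =
      μ.real (ball c) * ∫ t in ball c⁻¹, conj (f (x + t)) ∂μ := fun x => by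
    have hχx : Continuous fun ξ => (χ (ξ * x) : ℂ) :=
      continuous_subtype_val.comp (hχ.continuous.comp (continuous_id.mul continuous_const))
    rw [Fourier.fourierIntegral_def, ← integral_neg_eq_self]
    calc _ = ∫ ξ, Fourier.fourierIntegral χ μ (fun x => conj (f x)) ξ *
          (ball c).indicator (fun ξ => (χ (ξ * x) : ℂ)) ξ ∂μ := by
          refine integral_congr_ae (.of_forall fun ξ => ?_)
          by_cases hξ : ξ ∈ ball c
          · simp [hξ, neg_mem_ball, conj_fourierIntegral, Circle.smul_def, mul_comm]
          · simp [hξ, neg_mem_ball]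
      _ = ∫ y, conj (f y) * (ball c⁻¹).indicator (fun _ => (μ.real (ball c) : ℂ)) (y - x) ∂μ := by
          rw [integral_fourierIntegral_mul μ hχ hconj (hball _ hχx)]
          refine integral_congr_ae (.of_forall fun y => ?_)
          have : (ball c⁻¹).indicator (fun _ => (μ.real (ball c) : ℂ)) (y - x) =
              (ball c⁻¹).indicator (fun _ => (μ.real (ball c) : ℂ)) (x - y) := by
            rw [← neg_sub x y]
            by_cases h : x - y ∈ ball c⁻¹
            · rw [Set.indicator_of_mem h, Set.indicator_of_mem (neg_mem_ball.2 h)]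
            · rw [Set.indicator_of_notMem h, Set.indicator_of_notMem (neg_mem_ball.not.2 h)]
          simp only [this, ← setIntegral_character μ hχ hc, ← integral_indicator hB]
          rw [Fourier.fourierIntegral_def]
          congr 1
          refine integral_congr_ae (.of_forall fun ξ => ?_)
          by_cases hξ : ξ ∈ ball c
          · simp only [Set.indicator_of_mem hξ, Circle.smul_def, smul_eq_mul, ← Circle.coe_mul,
              ← AddChar.map_add_eq_mul]
            congr 2
            ring
          · simp [hξ]
      _ = _ := by
          rw [← integral_add_left_eq_self _ x, ← integral_const_mul, ← integral_indicator hB']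
          refine integral_congr_ae (.of_forall fun t => ?_)
          by_cases ht : t ∈ ball c⁻¹ <;> simp [ht, mul_comm]
  calc _ = ∫ ξ, Fourier.fourierIntegral χ μ f ξ *
          (ball c).indicator (fun ξ => conj (Fourier.fourierIntegral χ μ f ξ)) ξ ∂μ := by
        rw [← integral_indicator hB]
        simp only [Set.indicator_mul_right]
    _ = ∫ x, f x * (μ.real (ball c) * ∫ t in ball c⁻¹, conj (f (x + t)) ∂μ) ∂μ := by
        rw [integral_fourierIntegral_mul μ hχ hf
          (hball (fun ξ => conj _) (Complex.continuous_conj.comp hcont))]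
        simp only [hFg]
    _ = μ.real (ball c) * ∫ x, ∫ t in ball c⁻¹, f x * conj (f (x + t)) ∂μ ∂μ := by
        simp only [integral_const_mul]
        rw [← integral_const_mul]
        exact integral_congr_ae (.of_forall fun x => mul_left_comm _ _ _)
    _ = _ := by
        rw [integral_integral_swap (integrable_mul_conj_add hf _)]
        rfl

/-- The autocorrelation is an inner product of `f` with its translate, and translation is continuous
in `L²`. -/
lemma continuous_autocorrelation {f : K → ℂ} (hf : MemLp f 2 μ) :
    Continuous (autocorrelation μ f) := by
  have h : autocorrelation μ f = fun t =>
      inner ℂ (DomAddAct.mk t +ᵥ hf.toLp f) (hf.toLp f) := by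
    ext t
    rw [L2.inner_def]
    refine integral_congr_ae ?_
    have h1 := DomAddAct.vadd_Lp_ae_eq (DomAddAct.mk t) (hf.toLp f)
    have h2 : ∀ᵐ x ∂μ, hf.toLp f (t + x) = f (t + x) :=
      (measurePreserving_add_left μ t).quasiMeasurePreserving.ae hf.coeFn_toLp
    filter_upwards [h1, h2, hf.coeFn_toLp] with x h1 h2 h3
    rw [h1, h3]
    simp [h2, add_comm]
  have : Fact ((2 : ℝ≥0∞) ≠ ∞) := ⟨ENNReal.ofNat_ne_top⟩
  rw [h]
  exact (DomAddAct.continuous_mk.vadd continuous_const).inner continuous_const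

lemma tendsto_setIntegral_fourierIntegral (hχ : IsBasicCharacter χ) {f : K → ℂ}
    (hf : Integrable f μ) (hf2 : MemLp f 2 μ) {c : ℕ → K} (hc : ∀ n, c n ≠ 0)
    (hc0 : (𝓝 0).HasAntitoneBasis fun n => ball (c n)⁻¹) :
    Tendsto (fun n => ∫ ξ in ball (c n), Fourier.fourierIntegral χ μ f ξ *
      conj (Fourier.fourierIntegral χ μ f ξ) ∂μ) atTop
      (𝓝 (μ.real (ball 1) ^ 2 * autocorrelation μ f 0)) := by
  have hcont := continuous_autocorrelation hf2
  rw [Metric.tendsto_atTop]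
  intro ε hε
  have hm : 0 < μ.real (ball 1) ^ 2 := by
    have := ENNReal.toReal_pos (measure_ball_pos μ (one_ne_zero (α := K))).ne'
      (measure_ball_lt_top μ 1).ne
    exact pow_pos this 2
  -- The error is at most this bound times `μ(ball c) μ(ball c⁻¹) = μ(ball 1)²`, that is, `ε / 2`.
  have hδ : 0 < ε / (2 * μ.real (ball (1 : K)) ^ 2) := by positivity
  obtain ⟨N, -, hN⟩ := hc0.1.mem_iff.1
    (hcont.continuousAt.preimage_mem_nhds (Metric.ball_mem_nhds _ hδ))
  refine ⟨N, fun n hn => ?_⟩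
  have hsub := (hc0.2 hn).trans hN
  rw [dist_eq_norm, setIntegral_normSq_fourierIntegral hχ hf (hc n)]
  have hmul : (μ.real (ball 1) : ℂ) ^ 2 * autocorrelation μ f 0 =
      μ.real (ball (c n)) * ∫ t in ball (c n)⁻¹, autocorrelation μ f 0 ∂μ := by
    rw [setIntegral_const, Complex.real_smul, ← mul_assoc]
    norm_cast
    rw [measure_ball_mul_inv μ (hc n)]
  have hfin := measure_ball_lt_top μ (c n)⁻¹
  rw [hmul, ← mul_sub, ← integral_sub
    (hcont.continuousOn.integrableOn_compact (isCompact_ball _))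
    (integrableOn_const hfin.ne), norm_mul]
  have hle := norm_setIntegral_le_of_norm_le_const (μ := μ) (s := ball (c n)⁻¹)
    (f := fun t => autocorrelation μ f t - autocorrelation μ f 0) hfin
    (fun t ht => by simpa [dist_eq_norm] using (Metric.mem_ball.1 (hsub ht)).le)
  calc _ ≤ μ.real (ball (c n)) * (ε / (2 * μ.real (ball (1 : K)) ^ 2) * μ.real (ball (c n)⁻¹)) := by
        rw [Complex.norm_real, Real.norm_of_nonneg measureReal_nonneg]
        gcongr
    _ = ε / (2 * μ.real (ball (1 : K)) ^ 2) * (μ.real (ball (c n)) * μ.real (ball (c n)⁻¹)) := by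
        ring
    _ = ε / 2 := by
        rw [measure_ball_mul_inv μ (hc n)]
        rw [mul_comm 2, ← div_div, div_right_comm, div_mul_cancel₀ _ hm.ne']
    _ < ε := half_lt_self hε

lemma mul_conj_eq_ofReal (z : ℂ) : z * conj z = ((‖z‖ ^ 2 : ℝ) : ℂ) := by
  rw [Complex.mul_conj, Complex.normSq_eq_norm_sq]

/-- Plancherel's theorem for integrable square integrable functions. -/
lemma integrable_and_integral_fourierIntegral (hχ : IsBasicCharacter χ) {f : K → ℂ}
    (hf : Integrable f μ) (hf2 : MemLp f 2 μ) :
    Integrable (fun ξ => ‖Fourier.fourierIntegral χ μ f ξ‖ ^ 2) μ ∧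
    ∫ ξ, ‖Fourier.fourierIntegral χ μ f ξ‖ ^ 2 ∂μ = μ.real (ball 1) ^ 2 * ∫ x, ‖f x‖ ^ 2 ∂μ := by
  obtain ⟨c, hc, -, hcU, hc0⟩ := exists_ball_sequence K
  have hcov : AECover μ atTop fun n => ball (c n) :=
    ⟨.of_forall hcU, fun n => (isClosed_ball _).measurableSet⟩
  have hcont := (continuous_fourierIntegral μ hχ hf).norm.pow 2
  have hlim : Tendsto (fun n => ∫ ξ in ball (c n), ‖Fourier.fourierIntegral χ μ f ξ‖ ^ 2 ∂μ) atTop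
      (𝓝 (μ.real (ball 1) ^ 2 * ∫ x, ‖f x‖ ^ 2 ∂μ)) := by
    have := (Complex.continuous_re.tendsto _).comp
      (tendsto_setIntegral_fourierIntegral hχ hf hf2 hc hc0)
    simp only [autocorrelation, add_zero, mul_conj_eq_ofReal, integral_complex_ofReal,
      Function.comp_def, ← Complex.ofReal_pow, ← Complex.ofReal_mul, Complex.ofReal_re] at this
    exact this
  -- The integrand is nonnegative, so convergence of its integrals over exhausting balls already
  -- gives integrability.
  have hint := hcov.integrable_of_integral_tendsto_of_nonneg_ae _
    (fun n => hcont.continuousOn.integrableOn_compact (isCompact_ball _))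
    (.of_forall fun ξ => sq_nonneg _) hlim
  exact ⟨hint, tendsto_nhds_unique (hcov.integral_tendsto_of_countably_generated hint) hlim⟩

lemma memLp_fourierIntegral (hχ : IsBasicCharacter χ) {f : K → ℂ}
    (hf : Integrable f μ) (hf2 : MemLp f 2 μ) :
    MemLp (Fourier.fourierIntegral χ μ f) 2 μ :=
  (memLp_two_iff_integrable_sq_norm
    (continuous_fourierIntegral μ hχ hf).aestronglyMeasurable).2
    (integrable_and_integral_fourierIntegral hχ hf hf2).1

lemma eLpNorm_fourierIntegral (hχ : IsBasicCharacter χ) {f : K → ℂ}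
    (hf : Integrable f μ) (hf2 : MemLp f 2 μ) :
    eLpNorm (Fourier.fourierIntegral χ μ f) 2 μ = μ (ball 1) * eLpNorm f 2 μ := by
  have key := (integrable_and_integral_fourierIntegral hχ hf hf2).2
  rw [(memLp_fourierIntegral hχ hf hf2).eLpNorm_eq_integral_rpow_norm two_ne_zero
    ENNReal.ofNat_ne_top, hf2.eLpNorm_eq_integral_rpow_norm two_ne_zero ENNReal.ofNat_ne_top]
  simp only [ENNReal.toReal_ofNat, Real.rpow_ofNat, key]
  rw [Real.mul_rpow (by positivity) (by positivity), ENNReal.ofReal_mul (by positivity),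
    ← Real.rpow_natCast, ← Real.rpow_mul measureReal_nonneg]
  norm_num
  rw [Measure.real, ENNReal.ofReal_toReal (measure_ball_lt_top μ 1).ne]

end Plancherel
-- Inner products and limits in `L²`
section L2

variable {X Y : Type*} [MeasurableSpace X] [MeasurableSpace Y] {μ : Measure X} {ν : Measure Y}

lemma eLpNorm_two_sq (f : X → ℂ) : eLpNorm f 2 μ ^ 2 = ∫⁻ x, ‖f x‖ₑ ^ 2 ∂μ := by
  simpa using eLpNorm_nnreal_pow_eq_lintegral (f := f) (μ := μ) (p := 2) two_ne_zero

lemma l2Inner_eq_inner {f g : X → ℂ} (hf : MemLp f 2 μ) (hg : MemLp g 2 μ) :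
    l2Inner μ f g = inner ℂ (hg.toLp g) (hf.toLp f) := by
  rw [L2.inner_def]
  refine integral_congr_ae ?_
  filter_upwards [hf.coeFn_toLp, hg.coeFn_toLp] with x h1 h2
  rw [h1, h2]
  simp

/-- Proportional `L²` norms on a plane give proportional inner products. -/
lemma l2Inner_eq_mul_of_eLpNorm {f g : X → ℂ} {F G : Y → ℂ} (hf : MemLp f 2 μ) (hg : MemLp g 2 μ)
    (hF : MemLp F 2 ν) (hG : MemLp G 2 ν) (r : ℝ)
    (h : ∀ c : ℂ, (eLpNorm (G + c • F) 2 ν).toReal ^ 2 =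
      r * (eLpNorm (g + c • f) 2 μ).toReal ^ 2) :
    l2Inner ν F G = r * l2Inner μ f g := by
  have key : ∀ c : ℂ, ((‖hG.toLp G + c • hF.toLp F‖ : ℝ) : ℂ) ^ 2 =
      r * ((‖hg.toLp g + c • hf.toLp f‖ : ℝ) : ℂ) ^ 2 := fun c => by
    rw [← MemLp.toLp_const_smul, ← MemLp.toLp_const_smul, ← MemLp.toLp_add, ← MemLp.toLp_add,
      Lp.norm_toLp, Lp.norm_toLp]
    exact_mod_cast h c
  -- Polarization uses only the four values `c = ±1, ±i`.
  have h1 := key 1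
  have h2 := key (-1)
  have h3 := key Complex.I
  have h4 := key (-Complex.I)
  simp only [one_smul, neg_smul, ← sub_eq_add_neg] at h1 h2 h3 h4
  rw [l2Inner_eq_inner hF hG, l2Inner_eq_inner hf hg, inner_eq_sum_norm_sq_div_four,
    inner_eq_sum_norm_sq_div_four]
  simp only [RCLike.I_to_complex, Complex.coe_algebraMap]
  rw [h1, h2, h3, h4]
  ring

lemma tendsto_eLpNorm_add_smul {f g : X → ℂ} {u w : ℕ → X → ℂ} (hf : MemLp f 2 μ)
    (hg : MemLp g 2 μ) (hu : ∀ n, MemLp (u n) 2 μ) (hw : ∀ n, MemLp (w n) 2 μ)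
    (hut : Tendsto (fun n => eLpNorm (u n - f) 2 μ) atTop (𝓝 0))
    (hwt : Tendsto (fun n => eLpNorm (w n - g) 2 μ) atTop (𝓝 0)) (c : ℂ) :
    Tendsto (fun n => eLpNorm (u n + c • w n - (f + c • g)) 2 μ) atTop (𝓝 0) := by
  rw [← Lp.tendsto_Lp_iff_tendsto_eLpNorm'' _ (fun n => (hu n).add ((hw n).const_smul c)) _
    (hf.add (hg.const_smul c))]
  rw [← Lp.tendsto_Lp_iff_tendsto_eLpNorm'' _ hu _ hf] at hut
  rw [← Lp.tendsto_Lp_iff_tendsto_eLpNorm'' _ hw _ hg] at hwt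
  exact hut.add (hwt.const_smul c)

end L2

/-! ### The Fourier transform on `L²` -/

section Fourier

variable {K : Type*} [Field K] [ValuativeRel K] [TopologicalSpace K]
  [IsNonarchimedeanLocalField K] [MeasurableSpace K] [BorelSpace K]
  {χ : AddChar K Circle} {μ : Measure K} [μ.IsAddHaarMeasure]

lemma IsL2Fourier.add_smul (hχ : IsBasicCharacter χ) {f g F G : K → ℂ} (hf : MemLp f 2 μ)
    (hg : MemLp g 2 μ) (hfF : IsL2Fourier χ μ f F) (hgG : IsL2Fourier χ μ g G) (c : ℂ) :
    IsL2Fourier χ μ (f + c • g) (F + c • G) := by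
  obtain ⟨hF, u, hu, hut, huF⟩ := hfF
  obtain ⟨hG, w, hw, hwt, hwG⟩ := hgG
  refine ⟨hF.add (hG.const_smul c), fun n => u n + c • w n,
    fun n => ⟨(hu n).1.add ((hw n).1.smul c), (hu n).2.add ((hw n).2.const_smul c)⟩,
    tendsto_eLpNorm_add_smul hf hg (fun n => (hu n).2) (fun n => (hw n).2) hut hwt c, ?_⟩
  have : ∀ n, Fourier.fourierIntegral χ μ (u n + c • w n) =
      Fourier.fourierIntegral χ μ (u n) + c • Fourier.fourierIntegral χ μ (w n) := fun n => by
    rw [fourierIntegral_add μ hχ (hu n).1 ((hw n).1.smul c), Fourier.fourierIntegral_const_smul]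
  simp only [this]
  exact tendsto_eLpNorm_add_smul hF hG (fun n => memLp_fourierIntegral hχ (hu n).1 (hu n).2)
    (fun n => memLp_fourierIntegral hχ (hw n).1 (hw n).2) huF hwG c

lemma IsL2Fourier.congr_ae {f F F' : K → ℂ} (h : IsL2Fourier χ μ f F) (hF : F =ᵐ[μ] F') :
    IsL2Fourier χ μ f F' := by
  obtain ⟨h1, u, hu, hut, huF⟩ := h
  refine ⟨h1.ae_eq hF, u, hu, hut, ?_⟩
  simpa only [eLpNorm_congr_ae (EventuallyEq.rfl.sub hF)] using huF

lemma IsL2Fourier.eLpNorm_eq (hχ : IsBasicCharacter χ) {f F : K → ℂ} (hf : MemLp f 2 μ)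
    (h : IsL2Fourier χ μ f F) : eLpNorm F 2 μ = μ (ball 1) * eLpNorm f 2 μ := by
  obtain ⟨hF, u, hu, hut, huF⟩ := h
  have hû := fun n => memLp_fourierIntegral hχ (hu n).1 (hu n).2
  rw [← Lp.tendsto_Lp_iff_tendsto_eLpNorm'' _ (fun n => (hu n).2) _ hf] at hut
  rw [← Lp.tendsto_Lp_iff_tendsto_eLpNorm'' _ hû _ hF] at huF
  have hm := (measure_ball_lt_top μ (1 : K)).ne
  have key : ‖hF.toLp F‖ = μ.real (ball 1) * ‖hf.toLp f‖ := by
    refine tendsto_nhds_unique huF.norm ?_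
    convert! hut.norm.const_mul (μ.real (ball 1)) using 2 with n
    rw [Lp.norm_toLp, Lp.norm_toLp, eLpNorm_fourierIntegral hχ (hu n).1 (hu n).2,
      ENNReal.toReal_mul, Measure.real]
  rw [Lp.norm_toLp, Lp.norm_toLp, Measure.real, ← ENNReal.toReal_mul] at key
  exact (ENNReal.toReal_eq_toReal_iff' hF.eLpNorm_ne_top
    (ENNReal.mul_ne_top hm hf.eLpNorm_ne_top)).1 key

lemma IsL2Fourier.l2Inner_eq (hχ : IsBasicCharacter χ) {f g F G : K → ℂ} (hf : MemLp f 2 μ)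
    (hg : MemLp g 2 μ) (hfF : IsL2Fourier χ μ f F) (hgG : IsL2Fourier χ μ g G) :
    l2Inner μ F G = (μ.real (ball 1) ^ 2 : ℝ) * l2Inner μ f g := by
  refine l2Inner_eq_mul_of_eLpNorm hf hg hfF.1 hgG.1 _ fun c => ?_
  rw [(hgG.add_smul hχ hg hf hfF c).eLpNorm_eq hχ (hg.add (hf.const_smul c)), ENNReal.toReal_mul,
    mul_pow, Measure.real]

/-- Simple functions approximate `f`; their transforms form a Cauchy sequence because the transform
multiplies `L²` distances by `μ(ball 1)`, and `L²` is complete. -/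
lemma exists_isL2Fourier (hχ : IsBasicCharacter χ) {f : K → ℂ} (hf : MemLp f 2 μ) :
    ∃ F, IsL2Fourier χ μ f F := by
  have hex : ∀ n : ℕ, ∃ u : K → ℂ, (Integrable u μ ∧ MemLp u 2 μ) ∧
      eLpNorm (u - f) 2 μ ≤ ((n : ℝ≥0∞) + 1)⁻¹ := fun n => by
    obtain ⟨u, hu, hu2⟩ := hf.exists_simpleFunc_eLpNorm_sub_lt ENNReal.ofNat_ne_top
      (ε := ((n : ℝ≥0∞) + 1)⁻¹) (by simp)
    rw [← eLpNorm_neg, neg_sub] at hu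
    exact ⟨u, ⟨(SimpleFunc.memLp_iff_integrable two_ne_zero ENNReal.ofNat_ne_top).1 hu2, hu2⟩,
      hu.le⟩
  choose u hu hle using hex
  have hut : Tendsto (fun n => eLpNorm (u n - f) 2 μ) atTop (𝓝 0) := by
    refine tendsto_of_tendsto_of_tendsto_of_le_of_le tendsto_const_nhds ?_ (fun n => zero_le) hle
    simpa using (tendsto_add_atTop_iff_nat 1).2 ENNReal.tendsto_inv_nat_nhds_zero
  have hû := fun n => memLp_fourierIntegral hχ (hu n).1 (hu n).2
  have hlim := (Lp.tendsto_Lp_iff_tendsto_eLpNorm'' _ (fun n => (hu n).2) _ hf).2 hut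
  have hdist : ∀ m n, dist ((hû m).toLp _) ((hû n).toLp _) =
      μ.real (ball 1) * dist ((hu m).2.toLp _) ((hu n).2.toLp _) := fun m n => by
    have hsub : Fourier.fourierIntegral χ μ (u m) - Fourier.fourierIntegral χ μ (u n) =
        Fourier.fourierIntegral χ μ (u m - u n) := by
      have := fourierIntegral_add μ hχ ((hu m).1.sub (hu n).1) (hu n).1
      rw [sub_add_cancel] at this
      rw [this, add_sub_cancel_right]
    rw [dist_eq_norm, dist_eq_norm, ← MemLp.toLp_sub, ← MemLp.toLp_sub, Lp.norm_toLp, Lp.norm_toLp,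
      hsub, eLpNorm_fourierIntegral hχ ((hu m).1.sub (hu n).1) ((hu m).2.sub (hu n).2),
      ENNReal.toReal_mul, Measure.real]
  have hcau : CauchySeq fun n => (hû n).toLp _ := by
    have h0 := hlim.cauchySeq
    rw [cauchySeq_iff_tendsto_dist_atTop_0] at h0 ⊢
    simp only [hdist]
    simpa using h0.const_mul (μ.real (ball 1))
  obtain ⟨F, hF⟩ := cauchySeq_tendsto_of_complete hcau
  refine ⟨F, Lp.memLp F, u, hu, hut, ?_⟩
  rw [← Lp.tendsto_Lp_iff_tendsto_eLpNorm'' _ hû _ (Lp.memLp F), Lp.toLp_coeFn]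
  exact hF

lemma isL2Fourier_fourierL2 (hχ : IsBasicCharacter χ) {f : K → ℂ} (hf : MemLp f 2 μ) :
    IsL2Fourier χ μ f (fourierL2 χ μ f) :=
  Classical.epsilon_spec (exists_isL2Fourier hχ hf)

end Fourier

/-! ### Daughter wavelets and their Fourier transforms -/

section Daughter

variable {K : Type*} [Field K] [ValuativeRel K] [TopologicalSpace K]
  [IsNonarchimedeanLocalField K] [MeasurableSpace K] [BorelSpace K]

/-- The Fourier transform of `daughter ψ a b`, in terms of the Fourier transform `Ψ` of `ψ`. -/
noncomputable def daughterHat (χ : AddChar K Circle) (Ψ : K → ℂ) (a b ξ : K) : ℂ :=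
  (Real.sqrt (absK a) : ℂ) * χ (-(b * ξ)) * Ψ (a * ξ)

variable {χ : AddChar K Circle} {μ : Measure K} [μ.IsAddHaarMeasure]

lemma quasiMeasurePreserving_mul_left {a : K} (ha : a ≠ 0) :
    Measure.QuasiMeasurePreserving (a * ·) μ μ := by
  refine ⟨measurable_const_mul a, ?_⟩
  rw [map_mul_left_eq_smul μ ha]
  exact Measure.smul_absolutelyContinuous

lemma quasiMeasurePreserving_sub_div {a : K} (ha : a ≠ 0) (b : K) :
    Measure.QuasiMeasurePreserving (fun x => (x - b) / a) μ μ := by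
  convert! (quasiMeasurePreserving_mul_left (μ := μ) (inv_ne_zero ha)).comp
    (measurePreserving_sub_right μ b).quasiMeasurePreserving using 2 with x
  simp [div_eq_inv_mul]

lemma enorm_sqrt_sq (r : ℝ≥0) : ‖((Real.sqrt r : ℝ) : ℂ)‖ₑ ^ 2 = r := by
  rw [← ofReal_norm, Complex.norm_real, Real.norm_of_nonneg (Real.sqrt_nonneg _),
    ← ENNReal.ofReal_pow (Real.sqrt_nonneg _), Real.sq_sqrt r.coe_nonneg, ENNReal.ofReal_coe_nnreal]

lemma eLpNorm_daughter {a : K} (ha : a ≠ 0) (b : K) (f : K → ℂ) :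
    eLpNorm (daughter f a b) 2 μ = eLpNorm f 2 μ := by
  refine (ENNReal.pow_right_strictMono two_ne_zero).injective ?_
  have h0 : (absK a : ℝ≥0∞) ≠ 0 := by exact_mod_cast (absK_pos ha).ne'
  have hsq : ‖(((Real.sqrt (absK a))⁻¹ : ℝ) : ℂ)‖ₑ ^ 2 = (absK a : ℝ≥0∞)⁻¹ := by
    rw [← Real.sqrt_inv, ← NNReal.coe_inv, enorm_sqrt_sq, ENNReal.coe_inv (absK_pos ha).ne']
  simp only [eLpNorm_two_sq, daughter, enorm_mul, mul_pow, hsq]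
  rw [lintegral_const_mul' _ _ (ENNReal.inv_ne_top.2 h0),
    lintegral_sub_right_eq_self (fun x => ‖f (x / a)‖ₑ ^ 2) b]
  simp only [div_eq_inv_mul]
  rw [lintegral_comp_mul_left μ (inv_ne_zero ha) (fun x => ‖f x‖ₑ ^ 2), absK_inv,
    ENNReal.coe_inv (absK_pos ha).ne', inv_inv, ENNReal.inv_mul_cancel_left h0 ENNReal.coe_ne_top]

lemma eLpNorm_daughterHat {a : K} (ha : a ≠ 0) (b : K) (f : K → ℂ) :
    eLpNorm (daughterHat χ f a b) 2 μ = eLpNorm f 2 μ := by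
  refine (ENNReal.pow_right_strictMono two_ne_zero).injective ?_
  have h0 : (absK a : ℝ≥0∞) ≠ 0 := by exact_mod_cast (absK_pos ha).ne'
  have hχ : ∀ x, ‖(χ x : ℂ)‖ₑ = 1 := fun x => by rw [← ofReal_norm, Circle.norm_coe, ENNReal.ofReal_one]
  simp only [eLpNorm_two_sq, daughterHat, enorm_mul, mul_pow, enorm_sqrt_sq, hχ, mul_one]
  rw [lintegral_const_mul' _ _ ENNReal.coe_ne_top,
    lintegral_comp_mul_left μ ha (fun x => ‖f x‖ₑ ^ 2),
    ENNReal.mul_inv_cancel_left h0 ENNReal.coe_ne_top]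

/-- At `a = 0` the factor `(√0)⁻¹` takes the default value 0. -/
lemma daughter_zero (f : K → ℂ) (b : K) : daughter f 0 b = 0 := by
  ext x
  simp [daughter, absK_zero]

lemma memLp_daughter {f : K → ℂ} (hf : MemLp f 2 μ) (a b : K) : MemLp (daughter f a b) 2 μ := by
  rcases eq_or_ne a 0 with rfl | ha
  · rw [daughter_zero]; exact MemLp.zero
  refine ⟨?_, (eLpNorm_daughter ha b f).trans_lt hf.2⟩
  exact (hf.1.comp_quasiMeasurePreserving (quasiMeasurePreserving_sub_div ha b)).const_mul _

lemma memLp_daughterHat (hχ : IsBasicCharacter χ) {f : K → ℂ} (hf : MemLp f 2 μ) {a : K}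
    (ha : a ≠ 0) (b : K) : MemLp (daughterHat χ f a b) 2 μ := by
  refine ⟨?_, (eLpNorm_daughterHat ha b f).trans_lt hf.2⟩
  have hc : Continuous fun ξ => (Real.sqrt (absK a) : ℂ) * (χ (-(b * ξ)) : ℂ) :=
    continuous_const.mul (continuous_subtype_val.comp (hχ.continuous.comp (by fun_prop)))
  exact hc.aestronglyMeasurable.mul
    (hf.1.comp_quasiMeasurePreserving (quasiMeasurePreserving_mul_left ha))

lemma integrable_daughter {f : K → ℂ} (hf : Integrable f μ) {a : K} (ha : a ≠ 0) (b : K) :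
    Integrable (daughter f a b) μ := by
  have h : Integrable (fun x => f (a⁻¹ * x)) μ := by
    have := (hf.smul_measure_nnreal (c := (absK a⁻¹)⁻¹))
    rw [← map_mul_left_eq_smul μ (inv_ne_zero ha)] at this
    exact this.comp_measurable (measurable_const_mul _)
  have := (h.comp_sub_right b).const_mul (((Real.sqrt (absK a))⁻¹ : ℝ) : ℂ)
  convert! this using 2 with x
  simp [daughter, div_eq_inv_mul]

lemma fourierIntegral_daughter {a : K} (ha : a ≠ 0) (b : K) (f : K → ℂ) :
    Fourier.fourierIntegral χ μ (daughter f a b) =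
      daughterHat χ (Fourier.fourierIntegral χ μ f) a b := by
  ext ξ
  have hpos : (0 : ℝ) < absK a := by exact_mod_cast absK_pos ha
  have hsub := integral_sub_right_eq_self (μ := μ)
    (fun x => (χ (-((x + b) * ξ)) : ℂ) * ((((Real.sqrt (absK a))⁻¹ : ℝ) : ℂ) * f (a⁻¹ * x))) b
  have hmul := integral_comp_mul_left μ (inv_ne_zero ha)
    (fun y => (χ (-(y * (a * ξ))) : ℂ) * f y)
  simp only [sub_add_cancel] at hsub
  simp only [daughterHat, Fourier.fourierIntegral_def, Circle.smul_def, smul_eq_mul, daughter,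
    div_eq_inv_mul]
  rw [hsub]
  have hpt : ∀ x, (χ (-((x + b) * ξ)) : ℂ) * ((((Real.sqrt (absK a))⁻¹ : ℝ) : ℂ) * f (a⁻¹ * x)) =
      (((Real.sqrt (absK a))⁻¹ : ℝ) : ℂ) * χ (-(b * ξ)) *
        (χ (-(a⁻¹ * x * (a * ξ))) * f (a⁻¹ * x)) := fun x => by
    have : -((x + b) * ξ) = -(b * ξ) + -(a⁻¹ * x * (a * ξ)) := by field_simp; ring
    rw [this, AddChar.map_add_eq_mul, Circle.coe_mul]
    ring
  simp only [hpt]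
  rw [integral_const_mul, hmul, absK_inv, NNReal.coe_inv, inv_inv]
  have hs : (((Real.sqrt (absK a))⁻¹ : ℝ) : ℂ) * ((absK a : ℝ) : ℂ) = (Real.sqrt (absK a) : ℂ) := by
    rw [← Complex.ofReal_mul, inv_mul_eq_div, Real.div_sqrt]
  rw [← hs]
  ring

lemma IsL2Fourier.daughter (hχ : IsBasicCharacter χ) {ψ Ψ : K → ℂ}
    (h : IsL2Fourier χ μ ψ Ψ) {a : K} (ha : a ≠ 0) (b : K) :
    IsL2Fourier χ μ (daughter ψ a b) (daughterHat χ Ψ a b) := by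
  obtain ⟨hΨ, u, hu, hut, huΨ⟩ := h
  refine ⟨memLp_daughterHat hχ hΨ ha b, fun n => LocalFieldCWT.daughter (u n) a b,
    fun n => ⟨integrable_daughter (hu n).1 ha b, memLp_daughter (hu n).2 a b⟩, ?_, ?_⟩
  · have : ∀ n, LocalFieldCWT.daughter (u n) a b - LocalFieldCWT.daughter ψ a b =
        LocalFieldCWT.daughter (u n - ψ) a b := fun n => by
      ext x; simp [LocalFieldCWT.daughter, mul_sub]
    simpa only [this, eLpNorm_daughter ha] using hut
  · have : ∀ n, daughterHat χ (Fourier.fourierIntegral χ μ (u n)) a b - daughterHat χ Ψ a b =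
        daughterHat χ (Fourier.fourierIntegral χ μ (u n) - Ψ) a b := fun n => by
      ext x; simp [daughterHat, mul_sub]
    simpa only [fourierIntegral_daughter ha, this, eLpNorm_daughterHat ha] using huΨ

end Daughter
-- The wavelet transform and its norm
section Transform

variable {K : Type*} [Field K] [ValuativeRel K] [TopologicalSpace K]
  [IsNonarchimedeanLocalField K] [MeasurableSpace K] [BorelSpace K]
  {χ : AddChar K Circle} {μ : Measure K} [μ.IsAddHaarMeasure]

/-- Equality holds at every point, since `x ↦ (x - b) / a` pulls null sets back to null sets.
Measurable representatives may therefore replace `ψ` and `f`. -/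
lemma cwt_congr_ae {ψ ψ' f f' : K → ℂ} (hψ : ψ =ᵐ[μ] ψ') (hf : f =ᵐ[μ] f') :
    cwt μ ψ f = cwt μ ψ' f' := by
  ext ⟨a, b⟩
  rcases eq_or_ne a 0 with rfl | ha
  · simp [cwt, daughter_zero]
  refine integral_congr_ae ?_
  filter_upwards [hf, (quasiMeasurePreserving_sub_div ha b).ae_eq hψ] with x h1 h2
  simp only [Function.comp_apply] at h2
  simp only [daughter, h1, h2]

lemma stronglyMeasurable_cwt {ψ f : K → ℂ} (hψ : AEStronglyMeasurable ψ μ)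
    (hf : AEStronglyMeasurable f μ) : StronglyMeasurable (cwt μ ψ f) := by
  rw [cwt_congr_ae hψ.ae_eq_mk hf.ae_eq_mk]
  have h1 : Measurable fun q : (K × K) × K => hψ.mk ψ ((q.2 - q.1.2) / q.1.1) :=
    hψ.stronglyMeasurable_mk.measurable.comp
      ((measurable_snd.sub measurable_fst.snd).div measurable_fst.fst)
  have h2 : Measurable fun q : (K × K) × K => (((Real.sqrt (absK q.1.1))⁻¹ : ℝ) : ℂ) :=
    Complex.measurable_ofReal.comp
      (measurable_absK.comp measurable_fst.fst).coe_nnreal_real.sqrt.inv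
  have h3 : Measurable fun q : (K × K) × K => hf.mk f q.2 :=
    hf.stronglyMeasurable_mk.measurable.comp measurable_snd
  exact (h3.mul (Complex.continuous_conj.measurable.comp
    (h2.mul h1))).stronglyMeasurable.integral_prod_right

lemma cwt_add_smul {ψ f g : K → ℂ} (hψ : MemLp ψ 2 μ) (hf : MemLp f 2 μ) (hg : MemLp g 2 μ)
    (c : ℂ) : cwt μ ψ (g + c • f) = cwt μ ψ g + c • cwt μ ψ f := by
  ext ⟨a, b⟩
  have hd : MemLp (fun x => conj (daughter ψ a b x)) 2 μ := (memLp_daughter hψ a b).star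
  have h1 : Integrable (fun x => g x * conj (daughter ψ a b x)) μ := hg.integrable_mul hd
  have h2 : Integrable (fun x => c * (f x * conj (daughter ψ a b x))) μ :=
    (hf.integrable_mul hd).const_mul c
  simp only [cwt, Pi.add_apply, Pi.smul_apply, smul_eq_mul, ← integral_const_mul]
  rw [← integral_add h1 h2]
  exact integral_congr_ae (.of_forall fun x => by ring)

lemma cwt_eq_fourierIntegral (hχ : IsBasicCharacter χ) {ψ Ψ f Φ : K → ℂ} (hψ : MemLp ψ 2 μ)
    (hf : MemLp f 2 μ) (hΨ : IsL2Fourier χ μ ψ Ψ) (hΦ : IsL2Fourier χ μ f Φ) {a : K}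
    (ha : a ≠ 0) (b : K) :
    (μ.real (ball (1 : K)) ^ 2 : ℝ) * cwt μ ψ f (a, b) =
      Fourier.fourierIntegral χ μ (fun ξ => Φ ξ * conj (daughterHat χ Ψ a 0 ξ)) (-b) := by
  have h := hΦ.l2Inner_eq hχ hf (memLp_daughter hψ a b) (hΨ.daughter hχ ha b)
  rw [Fourier.fourierIntegral_def]
  refine h.symm.trans (integral_congr_ae (.of_forall fun ξ => ?_))
  have : conj (χ (-(b * ξ)) : ℂ) = χ (b * ξ) := by
    rw [← Circle.coe_inv_eq_conj, ← AddChar.map_neg_eq_inv, neg_neg]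
  simp only [daughterHat, map_mul, this, zero_mul, neg_zero, AddChar.map_zero_eq_one,
    Circle.coe_one, mul_one, Circle.smul_def, smul_eq_mul, mul_neg, neg_neg]
  rw [mul_comm ξ b]
  ring

/-- Plancherel applied to `G`. As a product of two `L²` functions `G` is only known to be
integrable; `hfin` supplies `G ∈ L²`. -/
lemma lintegral_cwt_slice (hχ : IsBasicCharacter χ) {ψ Ψ f Φ : K → ℂ} (hψ : MemLp ψ 2 μ)
    (hf : MemLp f 2 μ) (hΨ : IsL2Fourier χ μ ψ Ψ) (hΦ : IsL2Fourier χ μ f Φ) {a : K}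
    (ha : a ≠ 0) (hfin : ∫⁻ ξ, ‖Φ ξ * conj (daughterHat χ Ψ a 0 ξ)‖ₑ ^ 2 ∂μ < ∞) :
    μ (ball 1) ^ 2 * ∫⁻ b, ‖cwt μ ψ f (a, b)‖ₑ ^ 2 ∂μ =
      ∫⁻ ξ, ‖Φ ξ * conj (daughterHat χ Ψ a 0 ξ)‖ₑ ^ 2 ∂μ := by
  set G := fun ξ => Φ ξ * conj (daughterHat χ Ψ a 0 ξ) with hG
  have hd : MemLp (fun x => conj (daughterHat χ Ψ a 0 x)) 2 μ :=
    (memLp_daughterHat hχ hΨ.1 ha 0).star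
  have hG1 : Integrable G μ := hΦ.1.integrable_mul hd
  have hG2 : MemLp G 2 μ := by
    refine ⟨hG1.1, ?_⟩
    rw [← eLpNorm_two_sq] at hfin
    exact (ENNReal.pow_lt_top_iff.1 hfin).resolve_right two_ne_zero
  have hm := (measure_ball_pos μ (one_ne_zero (α := K))).ne'
  have hm' := (measure_ball_lt_top μ (1 : K)).ne
  have h1 : ∫⁻ b, ‖Fourier.fourierIntegral χ μ G (-b)‖ₑ ^ 2 ∂μ =
      μ (ball 1) ^ 2 * ∫⁻ ξ, ‖G ξ‖ₑ ^ 2 ∂μ := by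
    rw [lintegral_neg_eq_self (μ := μ) (fun b => ‖Fourier.fourierIntegral χ μ G b‖ₑ ^ 2),
      ← eLpNorm_two_sq, ← eLpNorm_two_sq, eLpNorm_fourierIntegral hχ hG1 hG2, mul_pow]
  have hr : ‖((μ.real (ball (1 : K)) ^ 2 : ℝ) : ℂ)‖ₑ = μ (ball (1 : K)) ^ 2 := by
    rw [← ofReal_norm, Complex.norm_real, Real.norm_of_nonneg (by positivity),
      ENNReal.ofReal_pow measureReal_nonneg, Measure.real, ENNReal.ofReal_toReal hm']
  simp only [hG, ← cwt_eq_fourierIntegral hχ hψ hf hΨ hΦ ha, enorm_mul, mul_pow _ _ 2, hr] at h1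
  rw [lintegral_const_mul' _ _ (by finiteness), pow_two (μ (ball (1 : K)) ^ 2), mul_assoc] at h1
  refine (ENNReal.mul_right_inj (pow_ne_zero 2 hm) (ENNReal.pow_ne_top hm')).1 (h1.trans ?_)
  simp only [enorm_mul, mul_pow]

/-- The measure `da / |a|` is invariant under `a ↦ aξ`. -/
lemma lintegral_enorm_sq_comp_mul_div_absK {ξ : K} (hξ : ξ ≠ 0) (Ψ : K → ℂ) :
    ∫⁻ a, ‖Ψ (a * ξ)‖ₑ ^ 2 / (absK a : ℝ≥0∞) ∂μ = ∫⁻ η, ‖Ψ η‖ₑ ^ 2 / (absK η : ℝ≥0∞) ∂μ := by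
  have h0 : (absK ξ : ℝ≥0∞) ≠ 0 := by exact_mod_cast (absK_pos hξ).ne'
  have h := lintegral_comp_mul_left μ hξ fun η => ‖Ψ η‖ₑ ^ 2 / (absK η : ℝ≥0∞)
  rw [← ENNReal.mul_inv_cancel_left h0 ENNReal.coe_ne_top
      (b := ∫⁻ η, ‖Ψ η‖ₑ ^ 2 / (absK η : ℝ≥0∞) ∂μ), ← h,
    ← lintegral_const_mul' _ _ ENNReal.coe_ne_top]
  refine lintegral_congr fun a => ?_
  rw [absK_mul, ENNReal.coe_mul, ENNReal.div_eq_inv_mul, ENNReal.div_eq_inv_mul,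
    ENNReal.mul_inv (.inl h0) (.inl ENNReal.coe_ne_top), mul_assoc,
    ENNReal.mul_inv_cancel_left h0 ENNReal.coe_ne_top, mul_comm a]

lemma lintegral_lintegral_daughterHat {Ψ Φ : K → ℂ} (hΨ : Measurable Ψ) (hΦ : Measurable Φ) :
    ∫⁻ a, ((absK a ^ 2)⁻¹ : ℝ≥0) * ∫⁻ ξ, ‖Φ ξ * conj (daughterHat χ Ψ a 0 ξ)‖ₑ ^ 2 ∂μ ∂μ =
      (∫⁻ η, ‖Ψ η‖ₑ ^ 2 / (absK η : ℝ≥0∞) ∂μ) * ∫⁻ ξ, ‖Φ ξ‖ₑ ^ 2 ∂μ := by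
  have hpt : ∀ a ≠ 0, ∀ ξ, (((absK a ^ 2)⁻¹ : ℝ≥0) : ℝ≥0∞) *
      ‖Φ ξ * conj (daughterHat χ Ψ a 0 ξ)‖ₑ ^ 2 =
      ‖Φ ξ‖ₑ ^ 2 * (‖Ψ (a * ξ)‖ₑ ^ 2 / (absK a : ℝ≥0∞)) := fun a ha ξ => by
    have hstar : ∀ z : ℂ, ‖conj z‖ₑ = ‖z‖ₑ := fun z => by
      rw [← ofReal_norm, RCLike.norm_conj, ofReal_norm]
    have h0 : (absK a : ℝ≥0∞) ≠ 0 := by exact_mod_cast (absK_pos ha).ne'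
    simp only [daughterHat, zero_mul, neg_zero, AddChar.map_zero_eq_one, Circle.coe_one, mul_one,
      enorm_mul, hstar, mul_pow, enorm_sqrt_sq]
    rw [ENNReal.coe_inv (pow_ne_zero 2 (absK_pos ha).ne'), ENNReal.coe_pow, pow_two (absK a : ℝ≥0∞),
      ENNReal.mul_inv (.inl h0) (.inl ENNReal.coe_ne_top), ENNReal.div_eq_inv_mul,
      mul_left_comm (‖Φ ξ‖ₑ ^ 2), mul_left_comm (‖Φ ξ‖ₑ ^ 2), mul_assoc,
      ENNReal.inv_mul_cancel_left h0 ENNReal.coe_ne_top]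
  have hmeas : Measurable fun p : K × K =>
      ‖Φ p.2‖ₑ ^ 2 * (‖Ψ (p.1 * p.2)‖ₑ ^ 2 / (absK p.1 : ℝ≥0∞)) :=
    ((hΦ.comp measurable_snd).enorm.pow_const 2).mul
      (((hΨ.comp (measurable_fst.mul measurable_snd)).enorm.pow_const 2).div
        (measurable_absK.comp measurable_fst).coe_nnreal_ennreal)
  have h0 : ∀ᵐ ξ : K ∂μ, ξ ≠ 0 := by simp [ae_iff, measure_singleton]
  simp only [← lintegral_const_mul' _ _ ENNReal.coe_ne_top]
  rw [lintegral_congr_ae (h0.mono fun a ha => lintegral_congr (hpt a ha)),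
    lintegral_lintegral_swap hmeas.aemeasurable, ← lintegral_const_mul _ (hΦ.enorm.pow_const 2)]
  refine lintegral_congr_ae ?_
  filter_upwards [h0] with ξ hξ
  rw [lintegral_const_mul' _ _ (by finiteness), lintegral_enorm_sq_comp_mul_div_absK hξ, mul_comm]

lemma eLpNorm_cwt_sq (hχ : IsBasicCharacter χ) {ψ f : K → ℂ} (hψ : IsAdmissible χ μ ψ)
    (hf : MemLp f 2 μ) : eLpNorm (cwt μ ψ f) 2 (cwtMeasure μ) ^ 2 =
      admissibilityConst χ μ ψ * eLpNorm f 2 μ ^ 2 := by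
  have hm := (measure_ball_pos μ (one_ne_zero (α := K))).ne'
  have hm' := (measure_ball_lt_top μ (1 : K)).ne
  have hΨ₀ := isL2Fourier_fourierL2 hχ hψ.1
  have hΦ₀ := isL2Fourier_fourierL2 hχ hf
  set Ψ := hΨ₀.1.1.mk _ with hΨdef
  set Φ := hΦ₀.1.1.mk _ with hΦdef
  have hΨ : IsL2Fourier χ μ ψ Ψ := hΨ₀.congr_ae hΨ₀.1.1.ae_eq_mk
  have hΦ : IsL2Fourier χ μ f Φ := hΦ₀.congr_ae hΦ₀.1.1.ae_eq_mk
  have hΨm : Measurable Ψ := hΨ₀.1.1.stronglyMeasurable_mk.measurable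
  have hΦm : Measurable Φ := hΦ₀.1.1.stronglyMeasurable_mk.measurable
  have hc : admissibilityConst χ μ ψ = ∫⁻ η, ‖Ψ η‖ₑ ^ 2 / (absK η : ℝ≥0∞) ∂μ := by
    refine lintegral_congr_ae ?_
    filter_upwards [hΨ₀.1.1.ae_eq_mk] with η h
    rw [h]
  have htot := lintegral_lintegral_daughterHat (χ := χ) (μ := μ) hΨm hΦm
  rw [← hc, ← eLpNorm_two_sq, hΦ.eLpNorm_eq hχ hf] at htot
  have hmeasG : Measurable fun a : K => (((absK a ^ 2)⁻¹ : ℝ≥0) : ℝ≥0∞) *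
      ∫⁻ ξ, ‖Φ ξ * conj (daughterHat χ Ψ a 0 ξ)‖ₑ ^ 2 ∂μ := by
    refine (measurable_absK.pow_const 2).inv.coe_nnreal_ennreal.mul
      (Measurable.lintegral_prod_right ?_)
    simp only [daughterHat, zero_mul, neg_zero, AddChar.map_zero_eq_one, Circle.coe_one, mul_one]
    refine (Measurable.mul (hΦm.comp measurable_snd) (Complex.continuous_conj.measurable.comp
      (Measurable.mul ?_ (hΨm.comp (measurable_fst.mul measurable_snd))))).enorm.pow_const 2
    exact Complex.measurable_ofReal.comp
      (measurable_absK.comp measurable_fst).coe_nnreal_real.sqrt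
  -- Finiteness of the double integral, from admissibility, gives for almost every `a` the square
  -- integrability needed for Plancherel on the slice.
  have hae := ae_lt_top hmeasG (htot.trans_lt
    (ENNReal.mul_lt_top hψ.2 (ENNReal.pow_lt_top
      (ENNReal.mul_lt_top hm'.lt_top hf.2)))).ne
  have h0 : ∀ᵐ a ∂μ, a ≠ 0 := by simp [ae_iff, measure_singleton]
  have hmeasK : Measurable fun p => ‖cwt μ ψ f p‖ₑ ^ 2 :=
    (stronglyMeasurable_cwt hψ.1.1 hf.1).measurable.enorm.pow_const 2
  have hw : Measurable fun p : K × K => (((absK p.1 ^ 2)⁻¹ : ℝ≥0) : ℝ≥0∞) :=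
    ((measurable_absK.comp measurable_fst).pow_const 2).inv.coe_nnreal_ennreal
  -- Both sides are compared after multiplication by `μ(ball 1)²`: one such factor comes from the
  -- slices, the other from the norm of `f̂`.
  refine (ENNReal.mul_right_inj (pow_ne_zero 2 hm) (ENNReal.pow_ne_top hm')).1 ?_
  rw [mul_pow, mul_left_comm] at htot
  rw [← htot, eLpNorm_two_sq, cwtMeasure, lintegral_withDensity_eq_lintegral_mul _ hw hmeasK,
    lintegral_prod _ (hw.mul hmeasK).aemeasurable,
    ← lintegral_const_mul' _ _ (ENNReal.pow_ne_top hm')]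
  refine lintegral_congr_ae ?_
  filter_upwards [hae, h0] with a hlt ha
  have hw0 : (((absK a ^ 2)⁻¹ : ℝ≥0) : ℝ≥0∞) ≠ 0 := by
    exact_mod_cast inv_ne_zero (pow_ne_zero 2 (absK_pos ha).ne')
  have hfin : ∫⁻ ξ, ‖Φ ξ * conj (daughterHat χ Ψ a 0 ξ)‖ₑ ^ 2 ∂μ < ∞ :=
    ENNReal.lt_top_of_mul_ne_top_right hlt.ne hw0
  simp only [Pi.mul_apply]
  rw [lintegral_const_mul' _ _ ENNReal.coe_ne_top, mul_left_comm,
    lintegral_cwt_slice hχ hψ.1 hf hΨ hΦ ha hfin]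

lemma memLp_cwt (hχ : IsBasicCharacter χ) {ψ f : K → ℂ} (hψ : IsAdmissible χ μ ψ)
    (hf : MemLp f 2 μ) : MemLp (cwt μ ψ f) 2 (cwtMeasure μ) := by
  refine ⟨(stronglyMeasurable_cwt hψ.1.1 hf.1).aestronglyMeasurable, ?_⟩
  have h : eLpNorm (cwt μ ψ f) 2 (cwtMeasure μ) ^ 2 < ∞ := by
    rw [eLpNorm_cwt_sq hχ hψ hf]
    exact ENNReal.mul_lt_top hψ.2 (ENNReal.pow_lt_top hf.2)
  exact (ENNReal.pow_lt_top_iff.1 h).resolve_right two_ne_zero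

end Transform
end LocalFieldCWT

theorem mainTheorem1 {K : Type*} [Field K] [ValuativeRel K] [TopologicalSpace K]
    [IsNonarchimedeanLocalField K] [MeasurableSpace K] [BorelSpace K]
    (μ : Measure K) [μ.IsAddHaarMeasure]
    (χ : AddChar K Circle) (hχ : LocalFieldCWT.IsBasicCharacter χ)
    (ψ : K → ℂ) (hψ : LocalFieldCWT.IsAdmissible χ μ ψ)
    (f g : K → ℂ) (hf : MemLp f 2 μ) (hg : MemLp g 2 μ) :
    MemLp (LocalFieldCWT.cwt μ ψ f) 2 (LocalFieldCWT.cwtMeasure μ) ∧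
    MemLp (LocalFieldCWT.cwt μ ψ g) 2 (LocalFieldCWT.cwtMeasure μ) ∧
    LocalFieldCWT.l2Inner (LocalFieldCWT.cwtMeasure μ)
        (LocalFieldCWT.cwt μ ψ f) (LocalFieldCWT.cwt μ ψ g) =
      ((LocalFieldCWT.admissibilityConst χ μ ψ).toReal : ℂ) * LocalFieldCWT.l2Inner μ f g ∧
    eLpNorm (LocalFieldCWT.cwt μ ψ f) 2 (LocalFieldCWT.cwtMeasure μ) ^ 2 =
      LocalFieldCWT.admissibilityConst χ μ ψ * eLpNorm f 2 μ ^ 2 := by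
  refine ⟨LocalFieldCWT.memLp_cwt hχ hψ hf, LocalFieldCWT.memLp_cwt hχ hψ hg,
    LocalFieldCWT.l2Inner_eq_mul_of_eLpNorm hf hg (LocalFieldCWT.memLp_cwt hχ hψ hf)
      (LocalFieldCWT.memLp_cwt hχ hψ hg) _ fun c => ?_, LocalFieldCWT.eLpNorm_cwt_sq hχ hψ hf⟩
  rw [← LocalFieldCWT.cwt_add_smul hψ.1 hf hg, ← ENNReal.toReal_pow,
    LocalFieldCWT.eLpNorm_cwt_sq hχ hψ (hg.add (hf.const_smul c)), ENNReal.toReal_mul,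
    ENNReal.toReal_pow]
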